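/- Let $p\ge 3$ be a prime, let $F$ be an algebraically closed field of characteristic $p$, and for $m\ge 0$ let $\Sigma_m$ denote the symmetric group. A partition $\lambda\vdash n$ is called $p$-regular if no part of $\lambda$ is repeated $p$ or more times. For a $p$-regular partition $\lambda\vdash n$ let $S^\lambda$ be the Specht module over $F$ (spanned by the polytabloids in the permutation module on $\lambda$-tabloids) and let $D^\lambda=S^\lambda/(S^\lambda\cap (S^\lambda)^\perp)$ be the irreducible $F\Sigma_n$-module indexed by $\lambda$, where $\perp$ is taken with respect to the bilinear form for which the tabloids are orthonormal. The Mullineux dual $\lambda^{\tt M}$ of $\lambda$ is the $p$-regular partition of $n$ with $D^{\lambda^{\tt M}}\cong D^\lambda\otimes\mathrm{sgn}$, where $\mathrm{sgn}$ is the sign representation of $\Sigma_n$. A $p$-regular partition $\lambda\vdash n$ with $n\geq 1$ is called a JS-partition if the restriction of $D^\lambda$ to $\Sigma_{n-1}$ is irreducible (equivalently, $\lambda$ has exactly one normal node). Let $h(\lambda)$ be the number of parts of $\lambda$. Let $\lambda\vdash n$ be a $p$-regular JS-partition with $\lambda=\lambda^{\tt M}$. Then $$n\equiv h(\lambda)^2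 \pmod p.$$ -/

import Mathlib

noncomputable section

namespace SymRep

open Equiv Finset

/-- A partition is `p`-regular if no (positive) part is repeated `p` or more times. -/
def IsPRegular (p : ℕ) (μ : YoungDiagram) : Prop :=
  ∀ a : ℕ, μ.rowLens.count a < p

/-- A `μ`-tableau with entries `Fin n`: a bijection of the entries with the nodes of `μ`.
`t x` is the node (row, column) containing the entry `x`. -/
abbrev Tableau (n : ℕ) (μ : YoungDiagram) : Type := Fin n ≃ μ.cells

/-- A `μ`-tabloid with entries `Fin n`: an assignment of a row to each entry such that row `i`
contains exactly `μ.rowLen i` entries. -/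
def Tabloid (n : ℕ) (μ : YoungDiagram) : Type :=
  {f : Fin n → Fin (μ.colLen 0) //
    ∀ i : Fin (μ.colLen 0), (univ.filter fun x => f x = i).card = μ.rowLen i}

instance (n : ℕ) (μ : YoungDiagram) : Fintype (Tabloid n μ) := by
  unfold Tabloid; infer_instance

instance (n : ℕ) (μ : YoungDiagram) : DecidableEq (Tabloid n μ) := by
  unfold Tabloid; infer_instance

/-- The symmetric group acts on tabloids by permuting the entries. -/
instance (n : ℕ) (μ : YoungDiagram) : MulAction (Perm (Fin n)) (Tabloid n μ) where
  smul σ T := ⟨fun x => T.1 (σ⁻¹ x), fun i => by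
    rw [← T.2 i]
    exact card_equiv σ⁻¹ (by intro x; simp)⟩
  one_smul T := rfl
  mul_smul σ τ T := Subtype.ext (funext fun x => by
    change T.1 ((σ * τ)⁻¹ x) = T.1 (τ⁻¹ (σ⁻¹ x))
    rw [mul_inv_rev]; rfl)

theorem Tabloid.smul_val {n : ℕ} {μ : YoungDiagram} (σ : Perm (Fin n)) (T : Tabloid n μ)
    (x : Fin n) : (σ • T).1 x = T.1 (σ⁻¹ x) := rfl

/-- The tabloid `{t}` of a tableau `t`: remember only the row of every entry. -/
def Tableau.tabloid {n : ℕ} {μ : YoungDiagram} (t : Tableau n μ) : Tabloid n μ :=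
  ⟨fun x => ⟨(t x).1.1, by
      have h : ((t x).1.1, (t x).1.2) ∈ μ := (t x).2
      exact lt_of_lt_of_le (YoungDiagram.mem_iff_lt_colLen.1 h)
        (μ.colLen_anti 0 _ (Nat.zero_le _))⟩, fun i => by
    rw [YoungDiagram.rowLen_eq_card]
    refine card_bij (fun x _ => (t x).1) ?_ ?_ ?_
    · intro x hx
      rw [mem_filter] at hx
      exact YoungDiagram.mem_row_iff.2 ⟨(t x).2, congrArg Fin.val hx.2⟩
    · intro x _ y _ h
      exact t.injective (Subtype.ext h)
    · intro c hc
      rw [YoungDiagram.mem_row_iff] at hc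
      refine ⟨t.symm ⟨c, hc.1⟩, ?_, by simp⟩
      rw [mem_filter]
      exact ⟨mem_univ _, Fin.ext (by simpa using hc.2)⟩⟩

/-- The symmetric group acts on tableaux by permuting the entries. -/
def Tableau.perm {n : ℕ} {μ : YoungDiagram} (σ : Perm (Fin n)) (t : Tableau n μ) :
    Tableau n μ := (σ⁻¹ : Perm (Fin n)).trans t

/-- The column stabilizer of `t`: the permutations preserving each column of `t`. -/
def Tableau.colStab {n : ℕ} {μ : YoungDiagram} (t : Tableau n μ) : Finset (Perm (Fin n)) :=
  univ.filter fun σ => ∀ x, (t (σ x)).1.2 = (t x).1.2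

variable (F : Type*) [Field F]

/-- The permutation module `M^μ` on the set of `μ`-tabloids, as a representation of `Σ_n` on the
functions on tabloids; the tabloid `T` is the basis vector `Pi.single T 1`. -/
def permRep (n : ℕ) (μ : YoungDiagram) :
    Representation F (Perm (Fin n)) (Tabloid n μ → F) where
  toFun σ := LinearMap.funLeft F F fun T => σ⁻¹ • T
  map_one' := by ext; simp [LinearMap.funLeft]
  map_mul' σ τ := by
    refine LinearMap.ext fun v => funext fun T => ?_
    simp [LinearMap.funLeft_apply, mul_smul]

theorem permRep_apply {n : ℕ} {μ : YoungDiagram} (σ : Perm (Fin n)) (v : Tabloid n μ → F)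
    (T : Tabloid n μ) : permRep F n μ σ v T = v (σ⁻¹ • T) := rfl

theorem permRep_single {n : ℕ} {μ : YoungDiagram} (σ : Perm (Fin n)) (T : Tabloid n μ) (a : F) :
    permRep F n μ σ (Pi.single T a) = Pi.single (σ • T) a := by
  funext U
  rw [permRep_apply]
  simp only [Pi.single_apply, inv_smul_eq_iff]

/-- The polytabloid `e_t = ∑ sgn(σ) σ{t}`, the sum being over the column stabilizer of `t`. -/
def polytabloid {n : ℕ} {μ : YoungDiagram} (t : Tableau n μ) : Tabloid n μ → F :=
  ∑ σ ∈ t.colStab, Pi.single (σ • t.tabloid) ((Perm.sign σ : ℤ) : F)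

theorem permRep_polytabloid {n : ℕ} {μ : YoungDiagram} (σ : Perm (Fin n)) (t : Tableau n μ) :
    permRep F n μ σ (polytabloid F t) = polytabloid F (t.perm σ) := by
  unfold polytabloid
  rw [map_sum]
  simp only [permRep_single]
  refine sum_bij (fun τ _ => σ * τ * σ⁻¹) ?_ ?_ ?_ ?_
  · intro τ hτ
    simp only [Tableau.colStab, mem_filter, mem_univ, true_and] at hτ ⊢
    intro x
    simpa [Tableau.perm] using hτ (σ⁻¹ x)
  · intro a _ b _ h
    simpa using h
  · intro τ hτ
    refine ⟨σ⁻¹ * τ * σ, ?_, by group⟩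
    simp only [Tableau.colStab, mem_filter, mem_univ, true_and] at hτ ⊢
    intro x
    simpa [Tableau.perm] using hτ (σ x)
  · intro τ _
    have h : (t.perm σ).tabloid = σ • t.tabloid := rfl
    rw [h, smul_smul, smul_smul]
    have hs : Perm.sign (σ * τ * σ⁻¹) = Perm.sign τ := by
      rw [Perm.sign_mul, Perm.sign_mul, Perm.sign_inv, mul_right_comm, Int.units_mul_self, one_mul]
    rw [hs, inv_mul_cancel_right]

/-- The Specht module `S^μ`: the span of all polytabloids in `M^μ`. -/
def specht (n : ℕ) (μ : YoungDiagram) : Submodule F (Tabloid n μ → F) :=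
  Submodule.span F (Set.range (polytabloid F : Tableau n μ → Tabloid n μ → F))

/-- The orthogonal complement of `S^μ` in `M^μ`, for the bilinear form in which the tabloids are
orthonormal. -/
def spechtPerp (n : ℕ) (μ : YoungDiagram) : Submodule F (Tabloid n μ → F) where
  carrier := {v | ∀ w ∈ specht F n μ, v ⬝ᵥ w = 0}
  add_mem' hv hv' w hw := by rw [add_dotProduct, hv w hw, hv' w hw, add_zero]
  zero_mem' w _ := zero_dotProduct w
  smul_mem' a v hv w hw := by rw [smul_dotProduct, hv w hw, smul_zero]

theorem specht_invariant (n : ℕ) (μ : YoungDiagram) (σ : Perm (Fin n)) :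
    specht F n μ ≤ (specht F n μ).comap (permRep F n μ σ) := by
  refine Submodule.span_le.2 ?_
  rintro _ ⟨t, rfl⟩
  change permRep F n μ σ (polytabloid F t) ∈ specht F n μ
  rw [permRep_polytabloid]
  exact Submodule.subset_span ⟨_, rfl⟩

theorem permRep_dotProduct {n : ℕ} {μ : YoungDiagram} (σ : Perm (Fin n))
    (v w : Tabloid n μ → F) :
    permRep F n μ σ v ⬝ᵥ w = v ⬝ᵥ permRep F n μ σ⁻¹ w := by
  simp only [dotProduct, permRep_apply, inv_inv]
  exact Fintype.sum_equiv (MulAction.toPerm σ⁻¹) _ _ (fun T => by simp)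

theorem spechtPerp_invariant (n : ℕ) (μ : YoungDiagram) (σ : Perm (Fin n)) :
    spechtPerp F n μ ≤ (spechtPerp F n μ).comap (permRep F n μ σ) := by
  intro v hv w hw
  rw [permRep_dotProduct]
  exact hv _ (specht_invariant F n μ σ⁻¹ hw)

/-- The Specht module as a representation of `Σ_n`. -/
def spechtRep (n : ℕ) (μ : YoungDiagram) :
    Representation F (Perm (Fin n)) (specht F n μ) :=
  (permRep F n μ).subrepresentation (specht F n μ) (specht_invariant F n μ)

/-- The submodule `S^μ ∩ (S^μ)^⊥` of `S^μ`. -/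
def spechtRad (n : ℕ) (μ : YoungDiagram) : Submodule F (specht F n μ) :=
  (spechtPerp F n μ).comap (specht F n μ).subtype

theorem spechtRad_invariant (n : ℕ) (μ : YoungDiagram) (σ : Perm (Fin n)) :
    spechtRad F n μ ≤ (spechtRad F n μ).comap (spechtRep F n μ σ) :=
  fun _ hv => spechtPerp_invariant F n μ σ hv

/-- The module `D^μ = S^μ / (S^μ ∩ (S^μ)^⊥)`. For `p`-regular `μ ⊢ n` and `F` of
characteristic `p` these are the irreducible `F Σ_n`-modules. -/
def simpleRep (n : ℕ) (μ : YoungDiagram) :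
    Representation F (Perm (Fin n)) (specht F n μ ⧸ spechtRad F n μ) :=
  (spechtRep F n μ).quotient (spechtRad F n μ) (spechtRad_invariant F n μ)

/-- The one-dimensional sign representation of `Σ_n`. -/
def signRep (n : ℕ) : Representation F (Perm (Fin n)) F where
  toFun σ := ((Perm.sign σ : ℤ) : F) • LinearMap.id
  map_one' := by ext; simp
  map_mul' σ τ := by ext; simp [mul_comm]

/-- `ν` is the Mullineux dual `μ^M` of `μ`: `D^ν ≅ D^μ ⊗ sgn` as `F Σ_n`-modules. Among
`p`-regular partitions of `n` such a `ν` exists and is unique. -/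
def IsMullineuxDual (n : ℕ) (μ ν : YoungDiagram) : Prop :=
  Nonempty ((simpleRep F n ν).Equiv ((simpleRep F n μ).tprod (signRep F n)))

/-- `μ` is a JS-partition of `n`: the restriction of `D^μ` to `Σ_{n-1}`, the stabilizer in `Σ_n`
of the last point, is irreducible. -/
def IsJS (n : ℕ) (μ : YoungDiagram) : Prop :=
  ∃ i : Fin n, (i : ℕ) + 1 = n ∧
    Representation.IsIrreducible
      ((simpleRep F n μ).comp (MulAction.stabilizer (Perm (Fin n)) i).subtype)

end SymRep

end

/-! Irreducibility over $\Sigma_{n-1}$ and Schur's lemma make the Jucys–Murphy sum $\sum_{j\ne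
i}(j\,i)$ a scalar $r$ on $D^\lambda$. Twisting by sgn negates it, so self-duality gives $r=-r$,
hence $r=0$ in odd characteristic (`sum_swap_eq_self`). Let $e\ne 0$ be the image of a polytabloid,
with first column $C$ and $h=|C|=h(\lambda)$. Evaluate $\sum_{k\in C}\sum_j (j\,k)e$ with $(k\,k)=1$
in two ways. Summing over $j$ first gives $h e$. Summing over $k$ first, each $j\in C$ gives
$(2-h)e$ by antisymmetry and each $j\notin C$ gives $e$ by a Garnir relation. So $h=h(2-h)+(n-h)$,
that is $n=h^2$ in $F$ (`card_eq_sq_of_garnir`). -/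

noncomputable section

namespace SymRep

open Equiv Finset

/-! ### Transposition sums in an arbitrary representation -/

section General

variable {F V : Type*} [Field F] [AddCommGroup V] [Module F V]

/-- If the transpositions within `C` negate `e`, then the transpositions within `C ∪ {j}` negate
`e - ∑ k ∈ C, (j k) e`. -/
theorem swap_sub_sum_swap {α : Type*} [DecidableEq α] (ρ : Representation F (Perm α) V)
    (C : Finset α) {j : α} (hj : j ∉ C) (e : V)
    (he : ∀ a ∈ C, ∀ b ∈ C, a ≠ b → ρ (swap a b) e = -e) {a b : α}
    (ha : a ∈ insert j C) (hb : b ∈ insert j C) (hab : a ≠ b) :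
    ρ (swap a b) (e - ∑ k ∈ C, ρ (swap j k) e) = -(e - ∑ k ∈ C, ρ (swap j k) e) := by
  -- $(j\,b)$ exchanges $e$ with $(j\,b)e$, and negates every other term since
  -- $(j\,b)(j\,k)=(j\,k)(k\,b)$.
  have key : ∀ b ∈ C,
      ρ (swap j b) (e - ∑ k ∈ C, ρ (swap j k) e) = -(e - ∑ k ∈ C, ρ (swap j k) e) := by
    intro b hb
    have hsum : ∑ k ∈ C.erase b, ρ (swap j b) (ρ (swap j k) e)
        = -∑ k ∈ C.erase b, ρ (swap j k) e := by
      rw [← sum_neg_distrib]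
      refine sum_congr rfl fun k hk => ?_
      have hkb := ne_of_mem_erase hk
      have hkC := mem_of_mem_erase hk
      have hkj : k ≠ j := fun h => hj (h ▸ hkC)
      have : swap j b * swap j k = swap j k * swap k b := by
        rw [swap_mul_eq_mul_swap, swap_inv, swap_apply_left, swap_apply_of_ne_of_ne
          (ne_of_mem_of_not_mem hb hj) hkb.symm]
      rw [← Module.End.mul_apply, ← map_mul, this, map_mul, Module.End.mul_apply,
        he k hkC b hb hkb, map_neg]
    rw [← add_sum_erase C _ hb, map_sub, map_add, map_sum, hsum, ← Module.End.mul_apply, ← map_mul,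
      swap_mul_self, map_one, Module.End.one_apply]
    abel
  rcases mem_insert.1 ha with rfl | ha'
  · exact key b ((mem_insert.1 hb).resolve_left hab.symm)
  rcases mem_insert.1 hb with rfl | hb'
  · rw [swap_comm]
    exact key a ha'
  -- A transposition within $C$ permutes the terms of the sum by conjugation.
  · rw [map_sub, he a ha' b hb' hab, map_sum, neg_sub', ← sum_neg_distrib, sub_right_inj]
    have hmem : ∀ k ∈ C, swap a b k ∈ C := by
      intro k hk
      by_cases h1 : k = a
      · rwa [h1, swap_apply_left]
      by_cases h2 : k = b
      · rwa [h2, swap_apply_right]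
      rwa [swap_apply_of_ne_of_ne h1 h2]
    refine sum_bij (fun k _ => swap a b k) hmem (fun x _ y _ h => (swap a b).injective h)
      (fun k hk => ⟨swap a b k, hmem k hk, by simp⟩) ?_
    · intro k hk
      have : swap a b * swap j k = swap j (swap a b k) * swap a b := by
        rw [mul_swap_eq_swap_mul, swap_apply_of_ne_of_ne (ne_of_mem_of_not_mem ha' hj).symm
          (ne_of_mem_of_not_mem hb' hj).symm]
      rw [← Module.End.mul_apply, ← map_mul, this, map_mul, Module.End.mul_apply,
        he a ha' b hb' hab, map_neg]

theorem sum_swap_conj {α : Type*} [DecidableEq α] [Fintype α] (ρ : Representation F (Perm α) V)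
    (σ : Perm α) (i : α) (v : V) :
    ρ σ (∑ j, ρ (swap j i) v) = ∑ j, ρ (swap j (σ i)) (ρ σ v) := by
  rw [map_sum]
  refine Fintype.sum_equiv σ _ _ fun j => ?_
  rw [← Module.End.mul_apply, ← map_mul, mul_swap_eq_swap_mul, map_mul, Module.End.mul_apply]

/-- If all Jucys–Murphy elements act as zero, then a nonzero vector satisfying the one-column
Garnir relations for `C` forces `|α| = |C|²` in the field. -/
theorem card_eq_sq_of_garnir {α : Type*} [DecidableEq α] [Fintype α]
    (ρ : Representation F (Perm α) V) (hρ : ∀ k v, ∑ j, ρ (swap j k) v = v)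
    (C : Finset α) {e : V} (he0 : e ≠ 0)
    (he : ∀ a ∈ C, ∀ b ∈ C, a ≠ b → ρ (swap a b) e = -e)
    (hgar : ∀ j ∉ C, ∑ k ∈ C, ρ (swap j k) e = e) :
    (Fintype.card α : F) = (#C : F) ^ 2 := by
  have h1 : ∑ k ∈ C, ∑ j, ρ (swap j k) e = (#C : F) • e := by
    rw [sum_congr rfl fun k _ => hρ k e, sum_const, Nat.cast_smul_eq_nsmul]
  -- The term $k=j$ is the identity; the other $|C|-1$ terms are each $-e$.
  have hin : ∀ j ∈ C, ∑ k ∈ C, ρ (swap j k) e = (2 - #C : F) • e := by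
    intro j hj
    rw [← add_sum_erase C _ hj, sum_congr rfl fun k hk =>
      he j hj k (mem_of_mem_erase hk) (ne_of_mem_erase hk).symm, sum_const, card_erase_of_mem hj,
      swap_self, ← Nat.cast_smul_eq_nsmul F, Nat.cast_sub (card_pos.2 ⟨j, hj⟩), smul_neg]
    have : ρ (Equiv.refl α) e = e := by
      change ρ 1 e = e
      rw [map_one, Module.End.one_apply]
    rw [this]
    module
  rw [sum_comm, ← sum_add_sum_compl C, sum_congr rfl hin,
    sum_congr (s₁ := Cᶜ) rfl fun j hj => hgar j (mem_compl.1 hj), sum_const, sum_const,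
    ← Nat.cast_smul_eq_nsmul F, ← Nat.cast_smul_eq_nsmul F, card_compl,
    Nat.cast_sub (card_le_univ C), smul_smul, ← add_smul] at h1
  have := smul_left_injective F he0 h1
  linear_combination this

/-- If the restriction of a representation to the stabilizer of `i` is irreducible and the
representation is isomorphic to its sign twist, then every Jucys–Murphy element acts as zero. -/
theorem sum_swap_eq_self {n : ℕ} [IsAlgClosed F] [FiniteDimensional F V] (h2 : (2 : F) ≠ 0)
    (ρ : Representation F (Perm (Fin n)) V) (i : Fin n)
    (hirr : Representation.IsIrreducible
      (ρ.comp (MulAction.stabilizer (Perm (Fin n)) i).subtype))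
    (φ : ρ.Equiv (ρ.tprod (signRep F n))) (k : Fin n) (v : V) :
    ∑ j, ρ (swap j k) v = v := by
  let L : V →ₗ[F] V := ∑ j ∈ univ.erase i, ρ (swap j i)
  have hL : ∀ v, ∑ j, ρ (swap j i) v = v + L v := by
    intro v
    rw [← add_sum_erase univ _ (mem_univ i), LinearMap.sum_apply, swap_self]
    congr 1
    change ρ 1 v = v
    rw [map_one, Module.End.one_apply]
  have hcomm : ∀ (g : MulAction.stabilizer (Perm (Fin n)) i) (v : V),
      L (ρ g.1 v) = ρ g.1 (L v) := by
    intro g v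
    have h := sum_swap_conj ρ g.1 i v
    have hg : g.1 i = i := g.2
    rw [hg, hL, hL, map_add] at h
    exact (add_left_cancel h).symm
  -- Schur's lemma for the restriction to the stabilizer of `i`.
  obtain ⟨r, hr⟩ := (Representation.IsIrreducible.algebraMap_intertwiningMap_bijective_of_isAlgClosed
    (ρ := ρ.comp (MulAction.stabilizer (Perm (Fin n)) i).subtype)).2
    (L.intertwiningMap_of_isIntertwiningMap _ _ hcomm)
  have hLr : ∀ v : V, L v = r • v := fun v => (congrArg (fun f => f.toLinearMap v) hr).symm
  have hsgn : ∀ w : TensorProduct F V F,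
      (∑ j ∈ univ.erase i, (ρ.tprod (signRep F n)) (swap j i)) w = -(r • w) := by
    intro w
    induction w using TensorProduct.induction_on with
    | zero => simp
    | add x y hx hy => rw [map_add, hx, hy, smul_add, neg_add]
    | tmul x y =>
      rw [LinearMap.sum_apply, TensorProduct.smul_tmul', ← hLr, LinearMap.sum_apply,
        TensorProduct.sum_tmul, ← sum_neg_distrib]
      refine sum_congr rfl fun j hj => ?_
      rw [Representation.tprod_apply, TensorProduct.map_tmul]
      simp [signRep, Perm.sign_swap (ne_of_mem_erase hj), TensorProduct.tmul_neg]
  have hr0 : ∀ v : V, r • v = 0 := by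
    intro v
    -- Transporting `L` through `φ` yields $r=-r$ on every vector.
    have h : φ.toLinearEquiv (L v) = -(r • φ.toLinearEquiv v) := by
      rw [← hsgn, LinearMap.sum_apply, LinearMap.sum_apply, map_sum]
      exact sum_congr rfl fun j _ => LinearMap.congr_fun (φ.isIntertwining' (swap j i)) v
    rw [hLr, map_smul, eq_neg_iff_add_eq_zero, ← two_smul F, ← map_smul, ← map_smul,
      LinearEquiv.map_eq_zero_iff] at h
    exact (smul_eq_zero.1 h).resolve_left h2
  have hi : ∀ v, ∑ j, ρ (swap j i) v = v := fun v => by rw [hL, hLr, hr0, add_zero]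
  -- Conjugation by $(i\,k)$ carries the result from `i` to any `k`.
  have hk := sum_swap_conj ρ (swap i k) i (ρ (swap i k) v)
  rw [hi, swap_apply_left, ← Module.End.mul_apply, ← map_mul, swap_mul_self, map_one,
    Module.End.one_apply] at hk
  exact hk.symm

end General

/-! ### Column relations for polytabloids -/

variable {F : Type*} [Field F] {n : ℕ} {μ : YoungDiagram}

/-- Left multiplication by $(a\,b)$ permutes the column stabilizer and reverses signs. -/
theorem permRep_swap_polytabloid (t : Tableau n μ) {a b : Fin n} (hab : a ≠ b)
    (h : (t a).1.2 = (t b).1.2) :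
    permRep F n μ (swap a b) (polytabloid F t) = -polytabloid F t := by
  have hcol : ∀ x, (t (swap a b x)).1.2 = (t x).1.2 := by
    intro x
    by_cases h1 : x = a
    · rw [h1, swap_apply_left, h]
    by_cases h2 : x = b
    · rw [h2, swap_apply_right, h]
    rw [swap_apply_of_ne_of_ne h1 h2]
  unfold polytabloid
  rw [map_sum, ← sum_neg_distrib]
  refine sum_bij (fun σ _ => swap a b * σ) ?_ ?_ ?_ ?_
  · intro σ hσ
    simp only [Tableau.colStab, mem_filter, mem_univ, true_and] at hσ ⊢
    intro x
    rw [Perm.mul_apply, hcol, hσ]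
  · intro x _ y _ h
    simpa using h
  · intro σ hσ
    refine ⟨swap a b * σ, ?_, by simp⟩
    simp only [Tableau.colStab, mem_filter, mem_univ, true_and] at hσ ⊢
    intro x
    rw [Perm.mul_apply, hcol, hσ]
  · intro σ _
    rw [permRep_single, smul_smul, Perm.sign_mul, Perm.sign_swap hab, ← Pi.single_neg]
    simp

/-- The entries in the first column of a tableau. -/
def Tableau.firstCol (t : Tableau n μ) : Finset (Fin n) :=
  univ.filter fun x => (t x).1.2 = 0

theorem Tableau.card_firstCol (t : Tableau n μ) : #t.firstCol = μ.colLen 0 := by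
  rw [YoungDiagram.colLen_eq_card]
  refine card_bij (fun x _ => (t x).1) ?_ ?_ ?_
  · intro x hx
    exact YoungDiagram.mem_col_iff.2 ⟨(t x).2, (mem_filter.1 hx).2⟩
  · intro x _ y _ h
    exact t.injective (Subtype.ext h)
  · intro c hc
    rw [YoungDiagram.mem_col_iff] at hc
    exact ⟨t.symm ⟨c, hc.1⟩, mem_filter.2 ⟨mem_univ _, by simpa using hc.2⟩, by simp⟩

/-- The Garnir relation for the first column and one further entry. -/
theorem sum_swap_polytabloid (h2 : (2 : F) ≠ 0) (t : Tableau n μ) {j : Fin n}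
    (hj : j ∉ t.firstCol) :
    ∑ k ∈ t.firstCol, permRep F n μ (swap j k) (polytabloid F t) = polytabloid F t := by
  have hA := fun {a b} => swap_sub_sum_swap (permRep F n μ) t.firstCol hj (polytabloid F t)
    (fun a ha b hb hab => permRep_swap_polytabloid t hab
      ((mem_filter.1 ha).2.trans (mem_filter.1 hb).2.symm)) (a := a) (b := b)
  refine (sub_eq_zero.1 (funext fun T => ?_)).symm
  -- The column has one entry per row, so with `j` added two entries `a`, `b` share a row of `T`.
  -- Then $(a\,b)$ fixes `T`, and antisymmetry makes the coefficient at `T` equal to its own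
  -- negative.
  obtain ⟨a, ha, b, hb, hab, hT⟩ := exists_ne_map_eq_of_card_lt_of_maps_to
    (s := insert j t.firstCol) (t := (univ : Finset (Fin (μ.colLen 0)))) (f := T.1)
    (by rw [card_insert_of_notMem hj, t.card_firstCol, card_univ, Fintype.card_fin]
        exact Nat.lt_succ_self _) (fun _ _ => mem_univ _)
  have hfix : (swap a b)⁻¹ • T = T := by
    refine Subtype.ext (funext fun x => ?_)
    rw [Tabloid.smul_val, inv_inv]
    by_cases h1 : x = a
    · rw [h1, swap_apply_left, hT]
    by_cases h2 : x = b
    · rw [h2, swap_apply_right, hT]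
    rw [swap_apply_of_ne_of_ne h1 h2]
  have h := congrFun (hA ha hb hab) T
  rw [permRep_apply, hfix, Pi.neg_apply, eq_neg_iff_add_eq_zero, ← two_mul] at h
  exact (mul_eq_zero.1 h).resolve_left h2

end SymRep

open SymRep in
theorem card_eq_sq_colLen {F : Type*} [Field F] [IsAlgClosed F] (h2 : (2 : F) ≠ 0) {n : ℕ}
    {μ : YoungDiagram} (hMull : IsMullineuxDual F n μ μ) (hJS : IsJS F n μ) :
    (n : F) = (μ.colLen 0 : F) ^ 2 := by
  obtain ⟨φ⟩ := hMull
  obtain ⟨i, -, hirr⟩ := hJS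
  have hzero := sum_swap_eq_self h2 (simpleRep F n μ) i hirr φ
  -- Otherwise $D^\mu=0$, which irreducibility of its restriction excludes.
  have hex : ∃ t : Tableau n μ, polytabloid F t ∉ spechtPerp F n μ := by
    by_contra! hall
    have hle : specht F n μ ≤ spechtPerp F n μ :=
      Submodule.span_le.2 (by rintro _ ⟨t, rfl⟩; exact hall t)
    have hsub : ∀ x : specht F n μ ⧸ spechtRad F n μ, x = 0 := by
      intro x
      obtain ⟨w, rfl⟩ := Submodule.Quotient.mk_surjective _ x
      exact (Submodule.Quotient.mk_eq_zero _).2 (hle w.2)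
    refine hirr.toNontrivial.exists_pair_ne.elim fun P ⟨Q, hPQ⟩ => hPQ ?_
    refine Subrepresentation.toSubmodule_injective (Submodule.ext fun x => ?_)
    rw [hsub x]
    exact iff_of_true (zero_mem _) (zero_mem _)
  obtain ⟨t, ht⟩ := hex
  let w : specht F n μ := ⟨polytabloid F t, Submodule.subset_span ⟨t, rfl⟩⟩
  have hmk : ∀ σ, simpleRep F n μ σ (Submodule.Quotient.mk w)
      = (spechtRad F n μ).mkQ (spechtRep F n μ σ w) := fun σ => rfl
  rw [← t.card_firstCol]
  convert card_eq_sq_of_garnir (simpleRep F n μ) hzero t.firstCol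
    (e := Submodule.Quotient.mk w) ?_ ?_ ?_
  · exact (Fintype.card_fin n).symm
  · rw [Ne, Submodule.Quotient.mk_eq_zero]
    exact ht
  · intro a ha b hb hab
    rw [hmk, show spechtRep F n μ (Equiv.swap a b) w = -w from
      Subtype.ext (permRep_swap_polytabloid t hab
        ((Finset.mem_filter.1 ha).2.trans (Finset.mem_filter.1 hb).2.symm)), map_neg]
    rfl
  · intro j hj
    simp only [hmk]
    rw [← map_sum, show ∑ k ∈ t.firstCol, spechtRep F n μ (Equiv.swap j k) w = w from
      Subtype.ext (by
        rw [AddSubmonoidClass.coe_finsetSum]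
        exact sum_swap_polytabloid h2 t hj)]
    rfl

end

theorem mainTheorem5 (p : ℕ) [Fact p.Prime] (hp : 3 ≤ p)
    (F : Type*) [Field F] [IsAlgClosed F] [CharP F p]
    (n : ℕ) (μ : YoungDiagram) (hn : μ.card = n)
    (hreg : SymRep.IsPRegular p μ)
    (hMull : SymRep.IsMullineuxDual F n μ μ)
    (hJS : SymRep.IsJS F n μ) :
    n ≡ μ.rowLens.length ^ 2 [MOD p] := by
  have h2 : (2 : F) ≠ 0 := by
    intro h
    have h' : ((2 : ℕ) : F) = 0 := by exact_mod_cast h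
    have := Nat.le_of_dvd two_pos ((CharP.cast_eq_zero_iff F p 2).1 h')
    omega
  rw [YoungDiagram.length_rowLens, Nat.ModEq, ← CharP.cast_eq_iff_mod_eq F p, Nat.cast_pow]
  exact card_eq_sq_colLen h2 hMull hJS
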